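/- **Theorem.** Let $\sigma:\mathbb{R}\to\mathbb{R}$ be a continuous function that is not a polynomial and that is continuously differentiable near some point $\alpha\in\mathbb{R}$ with $\sigma'(\alpha)\neq 0$. For a kernel $w=(w_{-1},w_0,w_1)\in\mathbb{R}^3$ and $x=(x_1,\dots,x_d)\in\mathbb{R}^d$ let $w\circledast x\in\mathbb{R}^d$ be the zero-padding convolution $(w\circledast x)_i=w_{-1}x_{i-1}+w_0x_i+w_1x_{i+1}$, where $x_0=x_{d+1}=0$. A three-kernel convolutional layer with $c$ input and $c'$ output channels is a map $C:\mathbb{R}^{c\times d}\to\mathbb{R}^{c'\times d}$ of the form $$C(x)^i=\sum_{j=1}^{c}w_{i,j}\circledast x^j+\delta_i\,(1,\dots,1),\qquad 1\le i\le c',$$ with kernels $w_{i,j}\in\mathbb{R}^3$ and biases $\delta_i\in\mathbb{R}$. A convolutional neural network with channel sizes $c_0,c_1,\dots,c_N$ ($N\ge 1$) is a map $C_N\circ\sigma\circ C_{N-1}\circ\dots\circ\sigma\circ C_1$, where $C_i$ is such a layer with $c_{i-1}$ input and $c_i$ output channels and $\sigma$ is applied componentwise. Let $c_x,c_y,d$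 be natural numbers, $K\subset\mathbb{R}^{c_x\times d}$ a compact set and $f$ a function from $\mathbb{R}^{c_x\times d}$ to $\mathbb{R}^{c_y\times d}$ that is continuous on $K$. Then for every $\varepsilon>0$ there is a convolutional neural network $g:\mathbb{R}^{c_x\times d}\to\mathbb{R}^{c_y\times d}$, with $c_x$ input channels, $c_y$ output channels and exactly $c_x+c_y+2$ channels in every hidden layer (hence at most $c_x+c_y+2$ channels throughout), such that $$\|f(x)-g(x)\|_2<\varepsilon\qquad\text{for all }x\in K.$$ -/

import Mathlib

namespace CNN

/-- Data with `c` channels of length `d`, i.e. an element of `ℝ^{c × d}`. Channels come first;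
positions are numbered `0, …, d - 1`. -/
abbrev Data (c d : ℕ) : Type := Fin c → Fin d → ℝ

/-- The Euclidean norm on `ℝ^{c × d}`. -/
noncomputable def l2norm {c d : ℕ} (x : Data c d) : ℝ :=
  Real.sqrt (∑ i, ∑ j, x i j ^ 2)

/-- A kernel `(w_{-k}, …, w_k)` of size `2k + 1`. -/
abbrev ConvKernel (k : ℕ) : Type := Finset.Icc (-(k : ℤ)) (k : ℤ) → ℝ

/-- Infinite-length convolution: `i ↦ ∑_{j = -k}^{k} w_j x_{i + j}`. -/
noncomputable def infConv {k : ℕ} (w : ConvKernel k) (x : ℤ → ℝ) : ℤ → ℝ :=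
  fun i => ∑ j, w j * x (i + (j : ℤ))

/-- The inclusion `ℝ^d → ℝ^ℤ` that fills in zeros. -/
def zeroExtend {d : ℕ} (x : Fin d → ℝ) : ℤ → ℝ :=
  fun i => if h : 0 ≤ i ∧ i < (d : ℤ) then x ⟨i.toNat, by omega⟩ else 0

/-- The projection `ℝ^ℤ → ℝ^d`. -/
def truncate (d : ℕ) (y : ℤ → ℝ) : Fin d → ℝ :=
  fun a => y ((a : ℕ) : ℤ)

/-- Zero padding convolution `w ⊛ x`. -/
noncomputable def zeroPadConv {k d : ℕ} (w : ConvKernel k) (x : Fin d → ℝ) : Fin d → ℝ :=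
  truncate d (infConv w (zeroExtend x))

/-- The parameters of a convolutional layer with `c₁` input channels, `c₂` output channels and
kernel size `2k + 1`: a kernel for every pair of channels and one bias per output channel. -/
structure ConvLayer (k c₁ c₂ : ℕ) where
  /-- the kernel from input channel `j` to output channel `i` is `kernel i j` -/
  kernel : Fin c₂ → Fin c₁ → ConvKernel k
  /-- the bias of each output channel, the same at all positions -/
  bias : Fin c₂ → ℝ

/-- The zero padding convolutional layer, as a map `ℝ^{c₁ × d} → ℝ^{c₂ × d}`. -/
noncomputable def ConvLayer.eval {k c₁ c₂ : ℕ} (C : ConvLayer k c₁ c₂) (d : ℕ) (x : Data c₁ d) : Data c₂ d :=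
  fun i a => (∑ j, zeroPadConv (C.kernel i j) (x j) a) + C.bias i

/-- The activation function applied to every component. -/
def applyAct (σ : ℝ → ℝ) {c d : ℕ} (x : Data c d) : Data c d :=
  fun i a => σ (x i a)

/-- `IsCNN σ k d cs f`: the map `f` is a zero padding convolutional neural network
`C_N ∘ σ ∘ C_{N-1} ∘ ⋯ ∘ σ ∘ C_1` with activation function `σ`, kernel size `2k + 1` and list of
channel sizes `cs = [c_0, c_1, …, c_N]`, `N ≥ 1`; the layer `C_i` maps `c_{i-1}` channels
to `c_i` channels. -/
inductive IsCNN (σ : ℝ → ℝ) (k d : ℕ) :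
    List ℕ → ∀ {c c' : ℕ}, (Data c d → Data c' d) → Prop
  | single {c c' : ℕ} (C : ConvLayer k c c') : IsCNN σ k d [c, c'] (C.eval d)
  | cons {c₀ c₁ c' : ℕ} {cs : List ℕ} (C : ConvLayer k c₀ c₁) {g : Data c₁ d → Data c' d}
      (hg : IsCNN σ k d (c₁ :: cs) g) :
      IsCNN σ k d (c₀ :: c₁ :: cs) (fun x => g (applyAct σ (C.eval d x)))

end CNN

/-!
The network keeps the `cx` input channels, accumulates the result in `cy` output channels, and has
one channel `a` for computations and one channel that holds zero.

*Exact operations in place of networks.* Networks whose outer layers are `1 × 1` convolutions are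
closed under composition, so their closure in the compact-open topology is too; its elements are
called implementable. The map `t ↦ (σ (α + h t) - σ α) / (h σ' α)` tends to the identity as `h → 0`,
locally uniformly, so implementable maps may apply `σ` to one channel and leave the others alone
(`implementable_act`). For convolutions the encoding `σ (α + h t)` has a defect: the constant `σ α`
is convolved too, and zero padding turns it into a large error at the boundary which no bias
corrects. A channel that holds zero carries the same constant, and convolving it with the negative
of the sum of the other kernels cancels the defect exactly. Thus every convolutional layer that
ignores one channel is implementable (`implementable_layer`).

*One neuron.* By a Horner scheme of translations the last entry of the channel `a` becomes any
linear form in all entries of the input (`reach_partial_sum`). After `σ` has been applied,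
translating to the left until that entry is the first pushes all others over the boundary;
translating to the right then moves it to any position, with zeros elsewhere, and it can be added to
an output channel (`Reach.add_neuron`). Zero padding is what makes this selection of a single entry
possible.

*Shallow networks are dense.* It remains to approximate each entry of `f` by sums of neurons. Let
`V` be the closed span of the functions `σ (l u + θ)` with `u` a linear form. Mollifications `g` of
`σ` give elements of `V` too, and differentiating `g (l u + θ)` `k` times in `l` at `l = 0` gives
`u ^ k * g⁽ᵏ⁾(θ)`. If `g⁽ᵏ⁾` vanished for all mollifications, `σ` would be a limit of polynomials of
degree at most `k`, hence a polynomial. So `V` contains all `u ^ k`, hence all `exp u`, and these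
span an algebra that is dense by the Stone–Weierstrass theorem (`eq_top_of_comp_mem`).
-/

/-! ### Density of shallow networks -/

section

open Filter Topology MeasureTheory
open scoped ContDiff Convolution

/-- A smooth function with vanishing `k`-th derivative coincides with its Lagrange interpolation
polynomial at the nodes `0, …, k`. Unlike the vanishing of the derivative, this identity passes to
pointwise limits. -/
theorem eval_interpolate_of_iteratedDeriv_eq_zero {g : ℝ → ℝ} (hg : ContDiff ℝ ∞ g) (k : ℕ)
    (h : ∀ t, iteratedDeriv k g t = 0) (t : ℝ) :
    g t = (Lagrange.interpolate (Finset.range (k + 1)) (fun i : ℕ => (i : ℝ))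
      (fun i => g i)).eval t := by
  have h' : iteratedDeriv (k + 1) g = 0 := by
    have : iteratedDeriv k g = 0 := funext h
    rw [iteratedDeriv_succ, this]
    exact deriv_zero
  let p : Polynomial ℝ := ∑ i ∈ Finset.range (k + 1),
    Polynomial.monomial i (iteratedDeriv i g 0 / (i.factorial : ℝ))
  -- the remainder in Taylor's formula at `0` is an integral of the derivative of order `k + 1`
  have hp : ∀ x, g x = p.eval x := by
    intro x
    rcases eq_or_ne (0 : ℝ) x with rfl | hx
    · simp [p, Polynomial.eval_finsetSum, Finset.sum_range_succ']
    · have hu : UniqueDiffOn ℝ (Set.uIcc 0 x) := uniqueDiffOn_Icc (by simpa [eq_comm] using hx)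
      have hd : ∀ i : ℕ, ∀ y ∈ Set.uIcc 0 x,
          iteratedDerivWithin i g (Set.uIcc 0 x) y = iteratedDeriv i g y := fun i y hy =>
        iteratedDerivWithin_eq_iteratedDeriv hu (hg.of_le (by exact_mod_cast le_top)).contDiffAt hy
      have := taylor_integral_remainder (f := g) (x₀ := 0) (x := x) (n := k)
        (hg.of_le (by exact_mod_cast le_top)).contDiffOn
      rw [intervalIntegral.integral_congr (g := fun _ => 0) (fun y hy => by
        simp only [hd (k + 1) y hy, h']; simp)] at this
      rw [intervalIntegral.integral_zero, sub_eq_zero, taylor_within_apply] at this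
      rw [this, Polynomial.eval_finsetSum]
      refine Finset.sum_congr rfl fun i _ => ?_
      rw [hd i 0 Set.left_mem_uIcc, Polynomial.eval_monomial, sub_zero, smul_eq_mul]
      ring
  have hdeg : p.degree < (Finset.range (k + 1)).card := by
    rw [Finset.card_range]
    refine lt_of_le_of_lt (Polynomial.degree_sum_le _ _) ?_
    rw [Finset.sup_lt_iff (by exact WithBot.bot_lt_coe _)]
    intro i hi
    exact lt_of_le_of_lt (Polynomial.degree_monomial_le _ _)
      (by exact_mod_cast Finset.mem_range.1 hi)
  have := Lagrange.eq_interpolate (s := Finset.range (k + 1)) (v := fun i : ℕ => (i : ℝ))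
    Nat.cast_injective.injOn hdeg
  simp only [hp]
  rw [← this]

/-- A closed subspace contains the integrals of functions with values in it. -/
theorem Submodule.integral_mem_of_isClosed {E S : Type*} [NormedAddCommGroup E] [NormedSpace ℝ E]
    [CompleteSpace E] [MeasurableSpace S] {μ : Measure S} (V : Submodule ℝ E)
    (hV : IsClosed (V : Set E)) {F : S → E} (hF : Integrable F μ) (h : ∀ s, F s ∈ V) :
    ∫ s, F s ∂μ ∈ V := by
  -- the integral vanishes in the quotient by `V`
  have h0 : V.mkQL (∫ s, F s ∂μ) = 0 := by
    rw [← ContinuousLinearMap.integral_comp_comm _ hF]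
    simp [fun s => (Submodule.Quotient.mk_eq_zero V).2 (h s)]
  simpa using h0

variable {X : Type*} [TopologicalSpace X]

/-- A closed subspace of `C(X, ℝ)` containing `σ (l u + θ)` for all `l` and `θ` also contains
`g (l u + θ)` for every mollification `g = φ ⋆ σ`. -/
theorem convolution_comp_mem [CompactSpace X] (V : Submodule ℝ C(X, ℝ))
    (hV : IsClosed (V : Set C(X, ℝ))) {σ : ℝ → ℝ} (hσ : Continuous σ) (u : C(X, ℝ))
    (h : ∀ l θ : ℝ, ∃ F ∈ V, ∀ x, F x = σ (l * u x + θ))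
    {φ : ℝ → ℝ} (hφ : Continuous φ) (hφc : HasCompactSupport φ) (l θ : ℝ) :
    ∃ F ∈ V, ∀ x, F x = (φ ⋆[ContinuousLinearMap.lsmul ℝ ℝ, volume] σ) (l * u x + θ) := by
  let γ : ℝ → C(X, ℝ) := fun s => φ s • ⟨fun x => σ (l * u x + θ - s), by fun_prop⟩
  have hγ : Continuous γ := hφ.smul (ContinuousMap.continuous_of_continuous_uncurry _ (by
    simp only [Function.uncurry_def, ContinuousMap.coe_mk]; fun_prop))
  have hγi : Integrable γ volume := hγ.integrable_of_hasCompactSupport hφc.smul_right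
  refine ⟨∫ s, γ s, V.integral_mem_of_isClosed hV hγi fun s => ?_, fun x => ?_⟩
  · obtain ⟨F, hF, hFe⟩ := h l (θ - s)
    refine V.smul_mem _ ?_
    convert hF using 1
    ext x
    simp [hFe, add_sub_assoc]
  · rw [← ContinuousMap.evalCLM_apply ℝ x, ← ContinuousLinearMap.integral_comp_comm _ hγi]
    rfl

/-- Differentiating `g (l u + θ)` with respect to `l` does not leave a closed subspace. -/
theorem pow_mul_iteratedDeriv_comp_mem (V : Submodule ℝ C(X, ℝ))
    (hV : IsClosed (V : Set C(X, ℝ))) {g : ℝ → ℝ} (hg : ContDiff ℝ ∞ g) (u : C(X, ℝ))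
    (h : ∀ l θ : ℝ, ∃ F ∈ V, ∀ x, F x = g (l * u x + θ)) (k : ℕ) (l θ : ℝ) :
    ∃ F ∈ V, ∀ x, F x = u x ^ k * iteratedDeriv k g (l * u x + θ) := by
  induction k generalizing l with
  | zero => simpa using h l θ
  | succ k ih =>
    have hc : Continuous (iteratedDeriv (k + 1) g) :=
      hg.continuous_iteratedDeriv _ (by exact_mod_cast le_top)
    have hd : ∀ t, HasDerivAt (iteratedDeriv k g) (iteratedDeriv (k + 1) g t) t := fun t => by
      rw [iteratedDeriv_succ]
      have hk := hg.differentiable_iteratedDeriv k (by exact_mod_cast WithTop.coe_lt_top _)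
      exact (hk t).hasDerivAt
    -- the difference quotient in `l` with step `η`, in a form that makes sense for `η = 0` as well
    let Φ : ℝ → C(X, ℝ) := fun η => ⟨fun x => u x ^ (k + 1) *
      ∫ s in (0 : ℝ)..1, iteratedDeriv (k + 1) g ((l + s * η) * u x + θ), by fun_prop⟩
    have hΦ : Continuous Φ := ContinuousMap.continuous_of_continuous_uncurry _ (by
      simp only [Function.uncurry_def, ContinuousMap.coe_mk, Φ]; fun_prop)
    have hmem : ∀ η, η ≠ 0 → Φ η ∈ V := by
      intro η hη
      obtain ⟨F₁, hF₁, hF₁e⟩ := ih (l + η)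
      obtain ⟨F₀, hF₀, hF₀e⟩ := ih l
      have : Φ η = η⁻¹ • (F₁ - F₀) := by
        ext x
        have hftc : ∫ s in (0 : ℝ)..1,
            iteratedDeriv (k + 1) g ((l + s * η) * u x + θ) * (η * u x) =
            iteratedDeriv k g ((l + 1 * η) * u x + θ) -
              iteratedDeriv k g ((l + 0 * η) * u x + θ) := by
          refine intervalIntegral.integral_eq_sub_of_hasDerivAt
            (f := fun s => iteratedDeriv k g ((l + s * η) * u x + θ)) (fun s _ => ?_)
            (Continuous.intervalIntegrable (by fun_prop) _ _)
          have hi : HasDerivAt (fun s : ℝ => (l + s * η) * u x + θ) (η * u x) s := by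
            simpa using ((((hasDerivAt_id s).mul_const η).const_add l).mul_const (u x)).add_const θ
          exact (hd _).comp s hi
        rw [intervalIntegral.integral_mul_const] at hftc
        simp only [one_mul, zero_mul, add_zero] at hftc
        simp only [Φ, ContinuousMap.coe_mk, ContinuousMap.smul_apply, ContinuousMap.sub_apply,
          hF₁e, hF₀e, smul_eq_mul, ← mul_sub, ← hftc]
        generalize (∫ s in (0 : ℝ)..1, iteratedDeriv (k + 1) g ((l + s * η) * u x + θ)) = J
        field_simp
        ring
      rw [this]
      exact V.smul_mem _ (V.sub_mem hF₁ hF₀)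
    refine ⟨Φ 0, ?_, fun x => by simp [Φ]⟩
    have hlim : Tendsto Φ (𝓝[≠] 0) (𝓝 (Φ 0)) := hΦ.continuousAt.tendsto.mono_left nhdsWithin_le_nhds
    exact hV.mem_of_tendsto hlim (eventually_nhdsWithin_of_forall hmem)

/-- The powers of `u` are obtained from derivatives at `l = 0`. For a given `k` some mollification
of `σ` has a nonzero `k`-th derivative somewhere, since `σ` would be a polynomial otherwise. -/
theorem pow_mem_of_comp_mem [CompactSpace X] (V : Submodule ℝ C(X, ℝ))
    (hV : IsClosed (V : Set C(X, ℝ))) {σ : ℝ → ℝ} (hσ : Continuous σ)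
    (hσp : ¬ ∃ p : Polynomial ℝ, ∀ t : ℝ, σ t = p.eval t)
    (u : C(X, ℝ)) (h : ∀ l θ : ℝ, ∃ F ∈ V, ∀ x, F x = σ (l * u x + θ)) (k : ℕ) : u ^ k ∈ V := by
  let φ : ℕ → ContDiffBump (0 : ℝ) := fun n =>
    ⟨1 / (n + 2 : ℝ), 1 / (n + 1 : ℝ), by positivity, by gcongr; norm_num⟩
  let g : ℕ → ℝ → ℝ := fun n => (φ n).normed volume ⋆[ContinuousLinearMap.lsmul ℝ ℝ, volume] σ
  have hg : ∀ n, ContDiff ℝ ∞ (g n) := fun n =>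
    (φ n).hasCompactSupport_normed.contDiff_convolution_left _ (φ n).contDiff_normed
      hσ.locallyIntegrable
  have hlim : ∀ t, Tendsto (fun n => g n t) atTop (𝓝 (σ t)) := fun t =>
    ContDiffBump.convolution_tendsto_right_of_continuous
      tendsto_one_div_add_atTop_nhds_zero_nat hσ t
  obtain ⟨n, θ₀, hθ⟩ : ∃ n θ, iteratedDeriv k (g n) θ ≠ 0 := by
    by_contra! hcon
    refine hσp ⟨Lagrange.interpolate (Finset.range (k + 1)) (fun i : ℕ => (i : ℝ))
      (fun i => σ i), fun t => tendsto_nhds_unique (hlim t) ?_⟩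
    simp only [fun n => eval_interpolate_of_iteratedDeriv_eq_zero (hg n) k (hcon n) t]
    simp only [Lagrange.interpolate_apply, Polynomial.eval_finsetSum, Polynomial.eval_mul,
      Polynomial.eval_C]
    exact tendsto_finsetSum _ fun i _ => (hlim i).mul_const _
  obtain ⟨F, hF, hFe⟩ := pow_mul_iteratedDeriv_comp_mem V hV (hg n) u
    (fun l θ => convolution_comp_mem V hV hσ u h ((φ n).contDiff_normed (n := 0)).continuous
      (φ n).hasCompactSupport_normed l θ) k 0 θ₀
  have : u ^ k = (iteratedDeriv k (g n) θ₀)⁻¹ • F := by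
    ext x
    simp [hFe]
    field_simp
  rw [this]
  exact V.smul_mem _ hF

/-- **Shallow networks are dense.** If `U` is closed under addition and separates points, then a
closed subspace that contains `σ (l u + θ)` for all `u ∈ U` and all `l`, `θ` is everything: it
contains `exp u = ∑ u ^ k / k!`, and these exponentials are closed under multiplication. -/
theorem eq_top_of_comp_mem [CompactSpace X] (V : Submodule ℝ C(X, ℝ))
    (hV : IsClosed (V : Set C(X, ℝ))) {σ : ℝ → ℝ} (hσ : Continuous σ)
    (hσp : ¬ ∃ p : Polynomial ℝ, ∀ t : ℝ, σ t = p.eval t)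
    (U : AddSubmonoid C(X, ℝ)) (hU : ∀ x y, x ≠ y → ∃ u ∈ U, u x ≠ u y)
    (h : ∀ u ∈ U, ∀ l θ : ℝ, ∃ F ∈ V, ∀ x, F x = σ (l * u x + θ)) : V = ⊤ := by
  let M : Submonoid C(X, ℝ) :=
    { carrier := NormedSpace.exp '' U
      one_mem' := ⟨0, U.zero_mem, NormedSpace.exp_zero⟩
      mul_mem' := by
        rintro _ _ ⟨u, hu, rfl⟩ ⟨v, hv, rfl⟩
        exact ⟨u + v, U.add_mem hu hv, NormedSpace.exp_add⟩ }
  have hM : Subalgebra.toSubmodule (Algebra.adjoin ℝ (M : Set C(X, ℝ))) ≤ V := by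
    rw [Algebra.adjoin_eq_span, Submonoid.closure_eq, Submodule.span_le]
    rintro _ ⟨u, hu, rfl⟩
    exact hV.mem_of_tendsto (NormedSpace.exp_series_hasSum_exp' (𝕂 := ℝ) u)
      (Eventually.of_forall fun s => V.sum_mem fun k _ =>
        V.smul_mem _ (pow_mem_of_comp_mem V hV hσ hσp u (h u hu) k))
  have hsep : (Algebra.adjoin ℝ (M : Set C(X, ℝ))).SeparatesPoints := by
    intro x y hxy
    obtain ⟨u, hu, hne⟩ := hU x y hxy
    refine ⟨_, ⟨NormedSpace.exp u, Algebra.subset_adjoin ⟨u, hu, rfl⟩, rfl⟩, fun he => hne ?_⟩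
    have hev : ∀ z, (NormedSpace.exp u : C(X, ℝ)) z = Real.exp (u z) := fun z => by
      rw [Real.exp_eq_exp_ℝ]
      exact NormedSpace.map_exp (ContinuousMap.evalAlgHom ℝ ℝ z)
        (ContinuousMap.evalCLM ℝ z).continuous u
    simp only [hev] at he
    exact Real.exp_injective he
  have htop := ContinuousMap.subalgebra_topologicalClosure_eq_top_of_separatesPoints _ hsep
  rw [eq_top_iff]
  intro f _
  have hf : f ∈ (Algebra.adjoin ℝ (M : Set C(X, ℝ))).topologicalClosure := by simp [htop]
  exact closure_minimal (s := (Algebra.adjoin ℝ (M : Set C(X, ℝ)) : Set C(X, ℝ))) hM hV hf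

end


namespace CNN

open Filter Topology

variable {σ : ℝ → ℝ} {k c c' c'' d W : ℕ}

/-! ### Convolutions and pointwise maps -/

theorem zeroExtend_natCast (x : Fin d → ℝ) (p : Fin d) : zeroExtend x (p : ℕ) = x p := by
  simp [zeroExtend]

theorem zeroExtend_of_neg (x : Fin d → ℝ) {p : ℤ} (hp : p < 0) : zeroExtend x p = 0 :=
  dif_neg (by omega)

theorem zeroExtend_of_le (x : Fin d → ℝ) {p : ℤ} (hp : (d : ℤ) ≤ p) : zeroExtend x p = 0 :=
  dif_neg (by omega)

/-- Zero padding convolution as a bilinear map. -/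
noncomputable def zeroPadConvₗ (k d : ℕ) : ConvKernel k →ₗ[ℝ] (Fin d → ℝ) →ₗ[ℝ] (Fin d → ℝ) :=
  LinearMap.mk₂ ℝ zeroPadConv
    (fun w w' x => by
      ext p
      simp [zeroPadConv, truncate, infConv, add_mul, Finset.sum_add_distrib])
    (fun r w x => by
      ext p
      simp [zeroPadConv, truncate, infConv, Finset.mul_sum, mul_assoc])
    (fun w x y => by
      have (i : ℤ) : zeroExtend (x + y) i = zeroExtend x i + zeroExtend y i := by
        unfold zeroExtend; split_ifs <;> simp
      ext p
      simp [zeroPadConv, truncate, infConv, this, mul_add, Finset.sum_add_distrib])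
    (fun r w x => by
      have (i : ℤ) : zeroExtend (r • x) i = r * zeroExtend x i := by
        unfold zeroExtend; split_ifs <;> simp
      ext p
      simp [zeroPadConv, truncate, infConv, this, Finset.mul_sum, mul_left_comm])

theorem ConvLayer.eval_apply (C : ConvLayer k c c') (x : Data c d) (i : Fin c') (p : Fin d) :
    C.eval d x i p = ∑ j, zeroPadConvₗ k d (C.kernel i j) (x j) p + C.bias i := rfl

theorem continuous_eval (C : ConvLayer k c c') : Continuous (C.eval d) := by
  have h : ∀ i j, Continuous (zeroPadConvₗ k d (C.kernel i j)) := fun i j =>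
    LinearMap.continuous_of_finiteDimensional _
  refine continuous_pi fun i => continuous_pi fun p => ?_
  simp only [C.eval_apply]
  exact (continuous_finsetSum _ fun j _ =>
    (continuous_apply p).comp ((h i j).comp (continuous_apply j))).add continuous_const

/-- The kernel whose only nonzero entry is a one at offset `s`: convolution with it is a translation
by `s` for `|s| ≤ 1`, `p ↦ x (p + s)`, where entries that cross the boundary are lost. -/
def shiftKernel (s : ℤ) : ConvKernel 1 := fun j => if (j : ℤ) = s then 1 else 0

theorem zeroPadConvₗ_shiftKernel {s : ℤ} (hs : s ∈ Finset.Icc (-((1 : ℕ) : ℤ)) ((1 : ℕ) : ℤ))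
    (x : Fin d → ℝ) (p : Fin d) :
    zeroPadConvₗ 1 d (shiftKernel s) x p = zeroExtend x ((p : ℕ) + s) := by
  change zeroPadConv (shiftKernel s) x p = _
  rw [zeroPadConv, truncate, infConv, Finset.sum_eq_single ⟨s, hs⟩]
  · simp [shiftKernel]
  · intro j _ hj
    have : (j : ℤ) ≠ s := fun h => hj (Subtype.ext h)
    simp [shiftKernel, this]
  · simp

@[simp]
theorem zeroPadConvₗ_shiftKernel_zero (x : Fin d → ℝ) :
    zeroPadConvₗ 1 d (shiftKernel 0) x = x := by
  ext p
  rw [zeroPadConvₗ_shiftKernel (by simp), add_zero, zeroExtend_natCast]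

/-- Maps that act by the same affine map of the channels at each position, i.e. `1 × 1`
convolutions. -/
def IsPointwise (F : Data c d → Data c' d) : Prop :=
  ∃ (A : Fin c' → Fin c → ℝ) (b : Fin c' → ℝ), ∀ x i p, F x i p = ∑ j, A i j * x j p + b i

theorem IsPointwise.exists_layer {F : Data c d → Data c' d} (hF : IsPointwise F) :
    ∃ C : ConvLayer 1 c c', C.eval d = F := by
  obtain ⟨A, b, h⟩ := hF
  refine ⟨⟨fun i j => A i j • shiftKernel 0, b⟩, ?_⟩
  ext x i p
  simp [ConvLayer.eval_apply, h]

theorem IsPointwise.continuous {F : Data c d → Data c' d} (hF : IsPointwise F) :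
    Continuous F := by
  obtain ⟨C, rfl⟩ := hF.exists_layer
  exact continuous_eval C

theorem IsPointwise.comp {F : Data c' d → Data c'' d} {G : Data c d → Data c' d}
    (hF : IsPointwise F) (hG : IsPointwise G) : IsPointwise (F ∘ G) := by
  obtain ⟨A, b, h⟩ := hF
  obtain ⟨A', b', h'⟩ := hG
  refine ⟨fun i j => ∑ m, A i m * A' m j, fun i => ∑ m, A i m * b' m + b i, fun x i p => ?_⟩
  simp only [Function.comp, h, h', mul_add, Finset.sum_add_distrib, Finset.mul_sum,
    Finset.sum_mul, mul_assoc]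
  rw [Finset.sum_comm]
  ring

/-- An affine map in each channel separately is pointwise. -/
theorem isPointwise_of_channelwise {F : Data c d → Data c d} (r b : Fin c → ℝ)
    (h : ∀ x i p, F x i p = r i * x i p + b i) : IsPointwise F :=
  ⟨fun i j => if i = j then r i else 0, b, fun x i p => by simp [h]⟩

/-! ### Implementable maps -/

/-- Composites `σ ∘ C_n ∘ ⋯ ∘ σ ∘ C_1` of hidden layers with `W` channels each. -/
inductive IsHidden (σ : ℝ → ℝ) (d W : ℕ) : (Data W d → Data W d) → Prop
  | id : IsHidden σ d W id
  | cons (C : ConvLayer 1 W W) {s : Data W d → Data W d} (hs : IsHidden σ d W s) :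
      IsHidden σ d W (fun x => s (applyAct σ (C.eval d x)))

theorem IsHidden.comp {s t : Data W d → Data W d} (hs : IsHidden σ d W s)
    (ht : IsHidden σ d W t) : IsHidden σ d W (s ∘ t) := by
  induction ht with
  | id => exact hs
  | cons C _ ih => exact IsHidden.cons C ih

theorem IsHidden.exists_isCNN {s : Data W d → Data W d} (hs : IsHidden σ d W s)
    (C : ConvLayer 1 W c') :
    ∃ n, IsCNN σ 1 d (W :: (List.replicate n W ++ [c'])) (fun x => C.eval d (s x)) := by
  induction hs with
  | id => exact ⟨0, IsCNN.single C⟩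
  | cons C' _ ih =>
    obtain ⟨n, hn⟩ := ih
    exact ⟨n + 1, IsCNN.cons C' hn⟩

/-- Networks of constant width `W` whose first and last layers are pointwise. Since pointwise maps
compose to pointwise maps, the composite of two such networks is again one; this fails for general
networks, where two convolutions would have to be merged into one layer. -/
def IsNet (σ : ℝ → ℝ) (F : Data W d → Data W d) : Prop :=
  ∃ P s Q, IsPointwise P ∧ IsHidden σ d W s ∧ IsPointwise Q ∧
    ∀ x, F x = P (s (applyAct σ (Q x)))

theorem IsNet.comp {F G : Data W d → Data W d} (hF : IsNet σ F) (hG : IsNet σ G) :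
    IsNet σ (F ∘ G) := by
  obtain ⟨P, s, Q, hP, hs, hQ, h⟩ := hF
  obtain ⟨P', s', Q', hP', hs', hQ', h'⟩ := hG
  obtain ⟨C, hC⟩ := (hQ.comp hP').exists_layer
  refine ⟨P, _, Q', hP, (IsHidden.cons C hs).comp hs', hQ', fun x => ?_⟩
  simp [h, h', hC]

/-- Maps that networks of type `IsNet` approximate uniformly on compact sets: the closure in the
compact-open topology. -/
def Implementable (σ : ℝ → ℝ) (T : Data W d → Data W d) : Prop :=
  ∃ F ∈ closure {F : C(Data W d, Data W d) | IsNet σ F}, ⇑F = T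

theorem Implementable.comp {S T : Data W d → Data W d} (hS : Implementable σ S)
    (hT : Implementable σ T) : Implementable σ (S ∘ T) := by
  obtain ⟨F, hF, rfl⟩ := hS
  obtain ⟨G, hG, rfl⟩ := hT
  refine ⟨F.comp G, ?_, rfl⟩
  exact map_mem_closure₂ (f := fun F G : C(Data W d, Data W d) => F.comp G)
    (ContinuousMap.continuous_comp'.comp continuous_swap) hF hG
    fun _ (hF : IsNet σ _) _ (hG : IsNet σ _) => hF.comp hG

theorem Implementable.exists_dist_lt {T : Data W d → Data W d} (hT : Implementable σ T)
    {K : Set (Data W d)} (hK : IsCompact K) {ε : ℝ} (hε : 0 < ε) :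
    ∃ G, IsNet σ G ∧ ∀ x ∈ K, dist (T x) (G x) < ε := by
  obtain ⟨F, hF, rfl⟩ := hT
  have hne := mem_closure_iff_nhdsWithin_neBot.1 hF
  have hlim : Tendsto id (𝓝[{F : C(Data W d, Data W d) | IsNet σ F}] F) (𝓝 F) :=
    tendsto_id.mono_right nhdsWithin_le_nhds
  rw [ContinuousMap.tendsto_iff_forall_isCompact_tendstoUniformlyOn] at hlim
  obtain ⟨G, hG, hd⟩ :=
    (eventually_mem_nhdsWithin.and (Metric.tendstoUniformlyOn_iff.1 (hlim K hK) ε hε)).exists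
  exact ⟨G, hG, hd⟩

/-- A limit for `h → 0` of networks depending continuously on `h` is implementable. -/
theorem implementable_of_family {F : ℝ → Data W d → Data W d}
    (hF : Continuous (Function.uncurry F)) (hnet : ∀ h, h ≠ 0 → IsNet σ (F h)) :
    Implementable σ (F 0) := by
  let Φ : ℝ → C(Data W d, Data W d) := fun h =>
    ⟨F h, hF.comp (continuous_const.prodMk continuous_id)⟩
  have hΦ : Continuous Φ := ContinuousMap.continuous_of_continuous_uncurry _ hF
  refine ⟨Φ 0, ?_, rfl⟩
  have hlim : Tendsto Φ (𝓝[≠] 0) (𝓝 (Φ 0)) := hΦ.continuousAt.tendsto.mono_left nhdsWithin_le_nhds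
  exact mem_closure_of_tendsto hlim (eventually_nhdsWithin_of_forall hnet)

/-! ### Activations and layers on some of the channels -/

/-- The difference quotient `(σ (α + h t) - σ α) / (h σ' α)`, extended by `t` to `h = 0`. -/
noncomputable def almostId (σ : ℝ → ℝ) (α h t : ℝ) : ℝ :=
  t * dslope σ α (α + h * t) / deriv σ α

section

variable {α : ℝ} (hα : deriv σ α ≠ 0)

include hα

theorem almostId_zero (t : ℝ) : almostId σ α 0 t = t := by
  simp [almostId, hα]

theorem act_eq_almostId (h t : ℝ) :
    σ (α + h * t) = σ α + h * deriv σ α * almostId σ α h t := by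
  have := sub_smul_dslope σ α (α + h * t)
  simp only [add_sub_cancel_left, smul_eq_mul] at this
  rw [← sub_eq_iff_eq_add', ← this, almostId]
  field_simp

theorem continuous_almostId (hσ : Continuous σ) :
    Continuous (Function.uncurry (almostId σ α)) := by
  have : Continuous (dslope σ α) := by
    rw [← continuousOn_univ, continuousOn_dslope univ_mem]
    exact ⟨hσ.continuousOn, differentiableAt_of_deriv_ne_zero hα⟩
  unfold almostId Function.uncurry
  fun_prop

/-- Applying the activation to a single channel is implementable: that channel passes the activation
unscaled, the others pass it as `α + h x`. -/
theorem implementable_act (hσ : Continuous σ) (a : Fin W) :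
    Implementable σ (fun (x : Data W d) i p => if i = a then σ (x i p) else x i p) := by
  have := implementable_of_family (σ := σ)
    (F := fun h (x : Data W d) i p => if i = a then σ (x i p) else almostId σ α h (x i p)) ?_ ?_
  · simpa only [almostId_zero hα] using this
  · have := continuous_almostId hα hσ
    refine continuous_pi fun i => continuous_pi fun p => ?_
    by_cases hi : i = a
    · simp only [Function.uncurry_def, hi, if_true]
      fun_prop
    · simp only [Function.uncurry_def, hi, if_false]
      exact this.comp (by fun_prop : Continuous fun z : ℝ × Data W d => (z.1, z.2 i p))
  · intro h hh
    refine ⟨fun x i p => (if i = a then 1 else (h * deriv σ α)⁻¹) * x i p +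
        (if i = a then 0 else -((h * deriv σ α)⁻¹ * σ α)), _,
      fun x i p => (if i = a then 1 else h) * x i p + (if i = a then 0 else α),
      isPointwise_of_channelwise _ _ fun _ _ _ => rfl, IsHidden.id,
      isPointwise_of_channelwise _ _ fun _ _ _ => rfl, fun x => ?_⟩
    ext i p
    by_cases hi : i = a
    · simp [applyAct, hi]
    · simp only [applyAct, id, hi, if_false, add_comm _ α, act_eq_almostId hα h]
      field_simp
      ring

/-- Every convolutional layer preceded by the erasure of one channel `b` is implementable. Encoding
`x` as `σ (α + h x) ≈ σ α + h σ' α x` adds a constant to all channels, which a convolution turns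
into a boundary effect that no bias can remove. The erased channel carries the same constant and
nothing else, so convolving it with minus the sum of the other kernels removes the boundary
effect. -/
theorem implementable_layer (hσ : Continuous σ) (C : ConvLayer 1 W W) (b : Fin W) :
    Implementable σ (fun x : Data W d => C.eval d (Function.update x b 0)) := by
  have := implementable_of_family (σ := σ) (F := fun h (x : Data W d) i p => almostId σ α h
    (C.eval d (fun j q => almostId σ α h (Function.update x b 0 j q)) i p)) ?_ ?_
  · simpa only [almostId_zero hα] using this
  · have := continuous_almostId hα hσ
    have hin : Continuous fun z : ℝ × Data W d =>
        C.eval d (fun j q => almostId σ α z.1 (Function.update z.2 b 0 j q)) := by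
      refine (continuous_eval C).comp (continuous_pi fun j => continuous_pi fun q => ?_)
      have hu : Continuous fun z : ℝ × Data W d => Function.update z.2 b 0 :=
        continuous_snd.update b continuous_const
      exact this.comp (continuous_fst.prodMk
        ((continuous_apply q).comp ((continuous_apply j).comp hu)))
    exact continuous_pi fun i => continuous_pi fun p => this.comp (continuous_fst.prodMk
      ((continuous_apply p).comp ((continuous_apply i).comp hin)))
  · intro h hh
    -- the kernels of `M` from all channels to a given one have sum zero, so `M` does not see `σ α`
    let D := h * deriv σ α
    have hD : D ≠ 0 := mul_ne_zero hh hα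
    let M : ConvLayer 1 W W :=
      ⟨fun i j => (h / D) • (C.kernel i j - if j = b then ∑ j', C.kernel i j' else 0),
        fun i => α + h * C.bias i⟩
    refine ⟨fun x i p => D⁻¹ * x i p + -(D⁻¹ * σ α), _,
      fun x i p => (if i = b then 0 else h) * x i p + α,
      isPointwise_of_channelwise _ _ fun _ _ _ => rfl, IsHidden.cons M IsHidden.id,
      isPointwise_of_channelwise _ _ fun _ _ _ => rfl, fun x => ?_⟩
    let y : Data W d := fun j q => almostId σ α h (Function.update x b 0 j q)
    have hyb : y b = 0 := by ext q; simp [y, almostId]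
    have hin : (applyAct σ fun i p => (if i = b then 0 else h) * x i p + α) =
        fun j => σ α • (1 : Fin d → ℝ) + D • y j := by
      ext j q
      have := act_eq_almostId hα h (Function.update x b 0 j q)
      simp only [applyAct, Pi.add_apply, Pi.smul_apply, smul_eq_mul, Pi.one_apply, mul_one, y, D,
        ← this]
      by_cases hj : j = b
      · subst hj; simp
      · simp [hj, add_comm]
    have hker : ∀ i, ∑ j, M.kernel i j = 0 := fun i => by
      simp [M, ← Finset.smul_sum]
    have hM : ∀ i p, M.eval d (fun j => σ α • (1 : Fin d → ℝ) + D • y j) i p =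
        α + h * C.eval d y i p := by
      intro i p
      have h1 : ∑ j, zeroPadConvₗ 1 d (M.kernel i j) (1 : Fin d → ℝ) p = 0 := by
        have := congrArg (fun w => zeroPadConvₗ 1 d w (1 : Fin d → ℝ) p) (hker i)
        simpa [map_sum] using this
      have h2 : ∀ j, zeroPadConvₗ 1 d (M.kernel i j) (y j) p =
          h / D * zeroPadConvₗ 1 d (C.kernel i j) (y j) p := by
        intro j
        by_cases hj : j = b
        · subst hj; simp [hyb]
        · simp [M, hj]
      simp only [ConvLayer.eval_apply, map_add, map_smul, Pi.add_apply, Pi.smul_apply, smul_eq_mul,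
        Finset.sum_add_distrib, ← Finset.mul_sum, h1, h2]
      simp only [M]
      field_simp
      ring
    ext i p
    simp only [hin, id, applyAct, hM, act_eq_almostId hα h]
    change almostId σ α h (C.eval d y i p) =
      D⁻¹ * (σ α + D * almostId σ α h (C.eval d y i p)) + -(D⁻¹ * σ α)
    field_simp
    ring

end

/-! ### Adding a neuron to the output -/

variable {cx cy : ℕ}

/-- The channels of a network: `cx` channels `x`, `cy` channels `y`, a channel `a` for computations
and a channel holding zero. -/
def pack (x : Data cx d) (y : Data cy d) (a : Fin d → ℝ) : Data (cx + cy + 2) d :=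
  Fin.append (Fin.append x y) ![a, 0]

/-- The input channels. -/
def inputs (X : Data (cx + cy + 2) d) : Data cx d := fun i => X (Fin.castAdd 2 (Fin.castAdd cy i))

/-- The output channels. -/
def outputs (X : Data (cx + cy + 2) d) : Data cy d := fun i => X (Fin.castAdd 2 (Fin.natAdd cx i))

@[simp]
theorem inputs_pack (x : Data cx d) (y : Data cy d) (a : Fin d → ℝ) :
    inputs (pack x y a) = x := by
  ext i; simp [inputs, pack]

@[simp]
theorem outputs_pack (x : Data cx d) (y : Data cy d) (a : Fin d → ℝ) :
    outputs (pack x y a) = y := by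
  ext i; simp [outputs, pack]

/-- A case distinction over the four groups of channels. -/
theorem forall_channel {P : Fin (cx + cy + 2) → Prop}
    (hx : ∀ i, P (Fin.castAdd 2 (Fin.castAdd cy i))) (hy : ∀ i, P (Fin.castAdd 2 (Fin.natAdd cx i)))
    (ha : P (Fin.natAdd (cx + cy) 0)) (hb : P (Fin.natAdd (cx + cy) 1)) (i) : P i := by
  refine Fin.addCases (fun j => Fin.addCases hx hy j) (fun j => ?_) i
  fin_cases j
  exacts [ha, hb]

theorem update_zero_eq_pack (X : Data (cx + cy + 2) d) :
    Function.update X (Fin.natAdd (cx + cy) 1) 0 =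
      pack (inputs X) (outputs X) (X (Fin.natAdd (cx + cy) 0)) := by
  funext i
  induction i using forall_channel with
  | hx i => rw [Function.update_of_ne (by simp [Fin.ext_iff]; omega)]; simp [pack, inputs]
  | hy i => rw [Function.update_of_ne (by simp [Fin.ext_iff]; omega)]; simp [pack, outputs]
  | ha => rw [Function.update_of_ne (by simp [Fin.ext_iff])]; simp [pack]
  | hb => rw [Function.update_self]; simp [pack]

/-- The layer that keeps the input channels, adds `v` times the computation channel `a` to the
output channels, and replaces `a` by `∑ u_j x_j + w ⊛ a + β`. -/
def stepLayer (u : Fin cx → ℝ) (v : Fin cy → ℝ) (w : ConvKernel 1) (β : ℝ) :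
    ConvLayer 1 (cx + cy + 2) (cx + cy + 2) where
  kernel := Fin.append
    (Fin.append
      (fun i => Fin.append (Fin.append (Pi.single i (shiftKernel 0)) 0) 0)
      (fun k => Fin.append (Fin.append 0 (Pi.single k (shiftKernel 0))) ![v k • shiftKernel 0, 0]))
    ![Fin.append (Fin.append (fun j => u j • shiftKernel 0) 0) ![w, 0], 0]
  bias := Fin.append 0 ![β, 0]

theorem eval_stepLayer (u : Fin cx → ℝ) (v : Fin cy → ℝ) (w : ConvKernel 1) (β : ℝ)
    (x : Data cx d) (y : Data cy d) (a : Fin d → ℝ) :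
    (stepLayer u v w β).eval d (pack x y a) = pack x (fun k p => y k p + v k * a p)
      (fun p => ∑ j, u j * x j p + zeroPadConvₗ 1 d w a p + β) := by
  funext i p
  rw [ConvLayer.eval_apply]
  have hs : ∀ {n} (i j : Fin n) (z : Fin d → ℝ),
      zeroPadConvₗ 1 d (Pi.single (M := fun _ => ConvKernel 1) i (shiftKernel 0) j) z p =
        if j = i then z p else 0 := by
    intro n i j z
    by_cases h : j = i
    · subst h; simp
    · simp [h]
  induction i using forall_channel with
  | hx i => simp [stepLayer, pack, Fin.sum_univ_add, hs]
  | hy i => simp [stepLayer, pack, Fin.sum_univ_add, hs]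
  | ha => simp [stepLayer, pack, Fin.sum_univ_add]
  | hb => simp [stepLayer, pack]

/-- The element of `ℝ^{c × d}` whose only nonzero entry is `t`, in channel `k` at position `q`. -/
def singleEntry {c : ℕ} (k : Fin c) (q : Fin d) (t : ℝ) : Data c d :=
  fun i p => if i = k ∧ p = q then t else 0

theorem singleEntry_add {c : ℕ} (k : Fin c) (q : Fin d) (s t : ℝ) :
    singleEntry k q (s + t) = singleEntry k q s + singleEntry k q t := by
  ext i p
  simp only [singleEntry, Pi.add_apply]
  split_ifs <;> simp

theorem singleEntry_mul {c : ℕ} (k : Fin c) (q : Fin d) (s t : ℝ) :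
    singleEntry k q (s * t) = s • singleEntry k q t := by
  ext i p
  simp [singleEntry]

/-- The map that keeps the input `x`, adds `Φ x` to the output channels and leaves `a x` in the
computation channel is implementable. -/
def Reach (σ : ℝ → ℝ) (a : Data cx d → Fin d → ℝ) (Φ : Data cx d → Data cy d) : Prop :=
  Implementable σ fun X : Data (cx + cy + 2) d =>
    pack (inputs X) (outputs X + Φ (inputs X)) (a (inputs X))

section

variable {α : ℝ} (hα : deriv σ α ≠ 0) (hσ : Continuous σ)

include hα hσ

theorem reach_zero : Reach (cx := cx) (cy := cy) (d := d) σ 0 0 := by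
  have := implementable_layer (d := d) hα hσ (stepLayer (cx := cx) (cy := cy) 0 0 0 0)
    (Fin.natAdd (cx + cy) 1)
  unfold Reach
  convert this using 2 with X
  rw [update_zero_eq_pack, eval_stepLayer]
  congr 1
  · ext; simp
  · ext; simp

variable {a : Data cx d → Fin d → ℝ} {Φ : Data cx d → Data cy d}

/-- The effect of a further layer `stepLayer`. With `u`, `w`, `β` zero it resets the computation
channel. -/
theorem Reach.step (h : Reach σ a Φ) (u : Fin cx → ℝ) (v : Fin cy → ℝ) (w : ConvKernel 1)
    (β : ℝ) :
    Reach σ (fun x p => ∑ j, u j * x j p + zeroPadConvₗ 1 d w (a x) p + β)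
      (fun x k p => Φ x k p + v k * a x p) := by
  have := (implementable_layer (d := d) hα hσ (stepLayer u v w β)
    (Fin.natAdd (cx + cy) 1)).comp h
  unfold Reach
  convert this using 2 with X
  rw [Function.comp, update_zero_eq_pack, inputs_pack, outputs_pack]
  have : pack (inputs X) (outputs X + Φ (inputs X)) (a (inputs X)) (Fin.natAdd (cx + cy) 0) =
      a (inputs X) := by simp [pack]
  rw [this, eval_stepLayer]
  congr 1
  ext k p
  simp [add_assoc]

/-- The translation of the computation channel by `s`. -/
theorem Reach.shift (h : Reach σ a Φ) {s : ℤ}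
    (hs : s ∈ Finset.Icc (-((1 : ℕ) : ℤ)) ((1 : ℕ) : ℤ)) :
    Reach σ (fun x p => zeroExtend (a x) ((p : ℕ) + s)) Φ := by
  simpa [zeroPadConvₗ_shiftKernel hs] using h.step hα hσ 0 0 (shiftKernel s) 0

/-- The activation is applied to the computation channel. -/
theorem Reach.act (h : Reach σ a Φ) : Reach σ (fun x p => σ (a x p)) Φ := by
  have := (implementable_act (d := d) hα hσ (Fin.natAdd (cx + cy) 0)).comp h
  unfold Reach
  convert this using 2 with X
  funext i p
  induction i using forall_channel with
  | hx i => rw [Function.comp, if_neg (by simp [Fin.ext_iff]; omega)]; simp [pack]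
  | hy i => rw [Function.comp, if_neg (by simp [Fin.ext_iff]; omega)]; simp [pack]
  | ha => simp [pack]
  | hb => rw [Function.comp, if_neg (by simp [Fin.ext_iff])]; simp [pack]

/-- A linear form in all entries of the input is computed at the last position as in Horner's
scheme: in each step the computation channel moves one position to the right, and the contribution
of the next position is added. -/
theorem reach_partial_sum (h : Reach σ 0 Φ) (w : Fin cx → Fin d → ℝ) (m : ℕ) (hm : m ≤ d) :
    ∃ a : Data cx d → Fin d → ℝ, Reach σ a Φ ∧ ∀ x, zeroExtend (a x) ((m : ℤ) - 1) =
      ∑ t ∈ Finset.range m, ∑ j, zeroExtend (w j) t * zeroExtend (x j) t := by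
  induction m with
  | zero => exact ⟨0, h, fun x => by simp [zeroExtend_of_neg]⟩
  | succ m ih =>
    obtain ⟨a, ha, hae⟩ := ih (by omega)
    refine ⟨_, by simpa using ha.step hα hσ (fun j => zeroExtend (w j) m) 0 (shiftKernel (-1)) 0,
      fun x => ?_⟩
    have : (((m + 1 : ℕ) : ℤ) - 1) = ((⟨m, by omega⟩ : Fin d) : ℕ) := by simp
    rw [this, zeroExtend_natCast, zeroPadConvₗ_shiftKernel (by simp), Finset.sum_range_succ, ← hae,
      add_comm]
    simp only [← sub_eq_add_neg, ← zeroExtend_natCast (x _)]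

/-- A neuron can be added to a single entry of the output. -/
theorem Reach.add_neuron (h : Reach σ 0 Φ) (w : Fin cx → Fin d → ℝ) (θ r : ℝ) (k : Fin cy)
    (q : Fin d) :
    Reach σ 0 (Φ + fun x => r • singleEntry k q (σ (∑ j, ∑ t, w j t * x j t + θ))) := by
  obtain ⟨a, ha, hae⟩ := reach_partial_sum hα hσ h w d le_rfl
  have hlast : ∀ x, zeroExtend (a x) ((d : ℤ) - 1) = ∑ j, ∑ t, w j t * x j t := fun x => by
    rw [hae, Finset.sum_range, Finset.sum_comm]
    simp only [zeroExtend_natCast]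
  have hneuron : Reach σ (fun x p => σ (a x p + θ)) Φ := by
    have := (ha.step hα hσ 0 0 (shiftKernel 0) θ).act hα hσ
    simpa using this
  -- moving left to the first position pushes all entries but the last one over the boundary
  have hleft : ∀ m : ℕ, ∃ b : Data cx d → Fin d → ℝ, Reach σ b Φ ∧ ∀ x (p : ℤ), 0 ≤ p →
      zeroExtend (b x) p = zeroExtend (fun p => σ (a x p + θ)) (p + m) := by
    intro m
    induction m with
    | zero => exact ⟨_, hneuron, fun x p _ => by simp⟩
    | succ m ih =>
      obtain ⟨b, hb, hbe⟩ := ih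
      refine ⟨_, hb.shift hα hσ (s := 1) (by simp), fun x p hp => ?_⟩
      rcases lt_or_ge p d with hpd | hpd
      · lift p to ℕ using hp
        have : (p : ℤ) = ((⟨p, by omega⟩ : Fin d) : ℕ) := rfl
        rw [this, zeroExtend_natCast, hbe x _ (by positivity)]
        congr 1
        push_cast
        ring
      · rw [zeroExtend_of_le _ hpd, zeroExtend_of_le _ (by push_cast; omega)]
  obtain ⟨b, hb, hbe⟩ := hleft (d - 1)
  -- moving right brings the remaining entry to the prescribed position
  have hright : ∀ m : ℕ, ∃ b' : Data cx d → Fin d → ℝ, Reach σ b' Φ ∧ ∀ x (p : ℤ), p < d →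
      zeroExtend (b' x) p = zeroExtend (b x) (p - m) := by
    intro m
    induction m with
    | zero => exact ⟨_, hb, fun x p _ => by simp⟩
    | succ m ih =>
      obtain ⟨b', hb', hbe'⟩ := ih
      refine ⟨_, hb'.shift hα hσ (s := -1) (by simp), fun x p hp => ?_⟩
      rcases lt_or_ge p 0 with hp0 | hp0
      · rw [zeroExtend_of_neg _ hp0, zeroExtend_of_neg _ (by push_cast; omega)]
      · lift p to ℕ using hp0
        have : (p : ℤ) = ((⟨p, by omega⟩ : Fin d) : ℕ) := rfl
        rw [this, zeroExtend_natCast, hbe' x _ (by simp; omega)]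
        congr 1
        push_cast
        ring
  obtain ⟨e, he, hee⟩ := hright q
  have hval : ∀ x p, e x p = (Pi.single q (σ (∑ j, ∑ t, w j t * x j t + θ)) : Fin d → ℝ) p := by
    intro x p
    have hq := q.2
    rw [← zeroExtend_natCast (e x), hee x _ (by simp)]
    rcases lt_trichotomy p q with hpq | rfl | hpq
    · rw [zeroExtend_of_neg _ (by have : (p : ℕ) < q := hpq; omega), Pi.single_eq_of_ne hpq.ne]
    · have hd : (0 : ℤ) + ((d - 1 : ℕ) : ℤ) = ((⟨d - 1, by omega⟩ : Fin d) : ℕ) := by simp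
      have hd' : ((d : ℤ) - 1) = ((⟨d - 1, by omega⟩ : Fin d) : ℕ) := by simp; omega
      have := hlast x
      rw [hd', zeroExtend_natCast] at this
      rw [sub_self, hbe x 0 le_rfl, hd, zeroExtend_natCast, Pi.single_eq_same, this]
    · have : (q : ℕ) < p := hpq
      rw [hbe x _ (by omega), zeroExtend_of_le _ (by omega), Pi.single_eq_of_ne hpq.ne']
  have := he.step hα hσ 0 (Pi.single k r) 0 0
  convert this using 1
  · ext; simp
  · ext x k' p
    rw [hval]
    by_cases hk : k' = k
    · subst hk; simp [singleEntry, Pi.single_apply]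
    · simp [singleEntry, hk]

/-! ### Density of the reachable maps -/

/-- Every continuous function on a compact set is approximated by maps that can be added to the
output channels. -/
theorem exists_reach_dist_lt (hσp : ¬ ∃ p : Polynomial ℝ, ∀ t : ℝ, σ t = p.eval t)
    {K : Set (Data cx d)} (hK : IsCompact K) {f : Data cx d → Data cy d} (hf : ContinuousOn f K)
    {δ : ℝ} (hδ : 0 < δ) :
    ∃ Φ : Data cx d → Data cy d, Reach σ 0 Φ ∧ ∀ x ∈ K, ∀ k q, dist (f x k q) (Φ x k q) < δ := by
  have := isCompact_iff_compactSpace.1 hK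
  let form : (Fin cx → Fin d → ℝ) → C(K, ℝ) := fun w =>
    ⟨fun x => ∑ j, ∑ t, w j t * x.1 j t,
      continuous_finsetSum _ fun j _ => continuous_finsetSum _ fun t _ => continuous_const.mul
        ((continuous_apply t).comp ((continuous_apply j).comp continuous_subtype_val))⟩
  let N : Set C(K, ℝ) := Set.range fun wθ : (Fin cx → Fin d → ℝ) × ℝ =>
    ⟨fun x => σ (form wθ.1 x + wθ.2), by fun_prop⟩
  let U : AddSubmonoid C(K, ℝ) :=
    { carrier := Set.range form
      zero_mem' := ⟨0, by ext; simp [form]⟩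
      add_mem' := by
        rintro _ _ ⟨w, rfl⟩ ⟨w', rfl⟩
        exact ⟨w + w', by ext; simp [form, add_mul, Finset.sum_add_distrib]⟩ }
  have htop : (Submodule.span ℝ N).topologicalClosure = ⊤ := by
    refine eq_top_of_comp_mem _ (Submodule.isClosed_topologicalClosure _) hσ hσp U ?_ ?_
    · intro x y hxy
      obtain ⟨j, t, hjt⟩ : ∃ j t, x.1 j t ≠ y.1 j t := by
        by_contra! hcon
        exact hxy (Subtype.ext (funext fun j => funext fun t => hcon j t))
      have hform : ∀ z : K, form (Pi.single j (Pi.single t 1)) z = z.1 j t := fun z => by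
        simp only [form, ContinuousMap.coe_mk]
        rw [Finset.sum_eq_single j (fun i _ hi => by simp [hi]) (by simp),
          Finset.sum_eq_single t (fun i _ hi => by simp [hi]) (by simp)]
        simp
      exact ⟨_, ⟨Pi.single j (Pi.single t 1), rfl⟩, by rwa [hform, hform]⟩
    · rintro _ ⟨w, rfl⟩ l θ
      refine ⟨_, Submodule.le_topologicalClosure _ (Submodule.subset_span ⟨(l • w, θ), rfl⟩),
        fun x => ?_⟩
      simp [form, Finset.mul_sum, mul_assoc]
  -- the factor `r` makes the claim stable under scalar multiples
  have hspan : ∀ F ∈ Submodule.span ℝ N, ∃ ψ : Data cx d → ℝ, (∀ x : K, ψ x = F x) ∧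
      ∀ (r : ℝ) (k : Fin cy) (q : Fin d) (Φ : Data cx d → Data cy d), Reach σ 0 Φ →
        Reach σ 0 (Φ + fun x => r • singleEntry k q (ψ x)) := by
    intro F hF
    induction hF using Submodule.span_induction with
    | mem F hF =>
      obtain ⟨⟨w, θ⟩, rfl⟩ := hF
      exact ⟨fun x => σ (∑ j, ∑ t, w j t * x j t + θ), fun x => rfl,
        fun r k q Φ hΦ => hΦ.add_neuron hα hσ w θ r k q⟩
    | zero => exact ⟨0, fun x => rfl, fun r k q Φ hΦ => by convert hΦ; ext; simp [singleEntry]⟩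
    | add F G _ _ ihF ihG =>
      obtain ⟨ψ, hψ, hψr⟩ := ihF
      obtain ⟨χ, hχ, hχr⟩ := ihG
      refine ⟨ψ + χ, fun x => by simp [hψ, hχ], fun r k q Φ hΦ => ?_⟩
      convert hχr r k q _ (hψr r k q Φ hΦ) using 1
      rw [add_assoc]
      congr 1
      ext1 x
      simp [singleEntry_add]
    | smul s F _ ih =>
      obtain ⟨ψ, hψ, hψr⟩ := ih
      refine ⟨s • ψ, fun x => by simp [hψ], fun r k q Φ hΦ => ?_⟩
      convert hψr (r * s) k q Φ hΦ using 1
      congr 1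
      ext1 x
      simp [singleEntry_mul, mul_smul]
  have happrox : ∀ kq : Fin cy × Fin d, ∃ ψ : Data cx d → ℝ,
      (∀ x ∈ K, dist (f x kq.1 kq.2) (ψ x) < δ) ∧ ∀ Φ : Data cx d → Data cy d, Reach σ 0 Φ →
        Reach σ 0 (Φ + fun x => singleEntry kq.1 kq.2 (ψ x)) := by
    rintro ⟨k, q⟩
    have hfc : Continuous (K.domRestrict f) := hf.domRestrict
    let fk : C(K, ℝ) := ⟨fun x => f x k q,
      (continuous_apply q).comp ((continuous_apply k).comp hfc)⟩
    have hmem : fk ∈ closure (Submodule.span ℝ N : Set C(K, ℝ)) := by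
      rw [← Submodule.topologicalClosure_coe, htop]
      trivial
    obtain ⟨F, hF, hFd⟩ := Metric.mem_closure_iff.1 hmem δ hδ
    obtain ⟨ψ, hψ, hψr⟩ := hspan F hF
    refine ⟨ψ, fun x hx => ?_, fun Φ hΦ => by simpa using hψr 1 k q Φ hΦ⟩
    rw [hψ ⟨x, hx⟩]
    exact ((ContinuousMap.dist_lt_iff hδ).1 hFd) ⟨x, hx⟩
  choose ψ hψ hψr using happrox
  have hsum : ∀ s : Finset (Fin cy × Fin d), Reach (d := d) σ 0
      (∑ kq ∈ s, fun x => singleEntry kq.1 kq.2 (ψ kq x) : Data cx d → Data cy d) := by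
    intro s
    induction s using Finset.induction_on with
    | empty => simpa using reach_zero hα hσ
    | insert kq s hs ih =>
      rw [Finset.sum_insert hs, add_comm]
      exact hψr kq _ ih
  refine ⟨_, hsum Finset.univ, fun x hx k q => ?_⟩
  convert hψ (k, q) x hx using 2
  rw [Finset.sum_apply, Finset.sum_apply, Finset.sum_apply, Finset.sum_eq_single (k, q)]
  · simp [singleEntry]
  · rintro ⟨k', q'⟩ _ hne
    exact if_neg fun h => hne (Prod.ext h.1.symm h.2.symm)
  · simp

end

/-! ### Approximation by networks of the required shape -/

theorem isPointwise_embed : IsPointwise fun x : Data cx d => pack x (0 : Data cy d) 0 := by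
  refine ⟨Fin.append (Fin.append (fun i => Pi.single i 1) 0) 0, 0, fun x i p => ?_⟩
  induction i using forall_channel with
  | hx i => simp [pack, Pi.single_apply]
  | hy i => simp [pack]
  | ha => simp [pack]
  | hb => simp [pack]

theorem isPointwise_outputs : IsPointwise (outputs (cx := cx) (cy := cy) (d := d)) := by
  refine ⟨fun k => Fin.append (Fin.append 0 (Pi.single k 1)) 0, 0, fun x i p => ?_⟩
  simp [outputs, Fin.sum_univ_add, Pi.single_apply]

/-- The embedding of the input and the projection to the output channels are pointwise, so they
merge with the outer layers. -/
theorem IsNet.exists_isCNN {G : Data (cx + cy + 2) d → Data (cx + cy + 2) d} (hG : IsNet σ G) :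
    ∃ n, IsCNN σ 1 d (cx :: (List.replicate n (cx + cy + 2) ++ [cy]))
      (fun x => outputs (G (pack x (0 : Data cy d) 0))) := by
  obtain ⟨P, s, Q, hP, hs, hQ, h⟩ := hG
  obtain ⟨A, hA⟩ := (isPointwise_outputs.comp hP).exists_layer
  obtain ⟨B, hB⟩ := (hQ.comp isPointwise_embed).exists_layer
  obtain ⟨n, hn⟩ := hs.exists_isCNN A
  refine ⟨n + 1, ?_⟩
  have hcomp : (fun x => outputs (G (pack x (0 : Data cy d) 0))) =
      fun x => (fun z => A.eval d (s z)) (applyAct σ (B.eval d x)) := by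
    funext x
    simp [hA, hB, h]
  rw [hcomp]
  exact IsCNN.cons B hn

/-- Entrywise smallness suffices for smallness in the Euclidean norm. -/
theorem exists_l2norm_lt (c d : ℕ) {ε : ℝ} (hε : 0 < ε) :
    ∃ δ > 0, ∀ x : Data c d, (∀ i p, |x i p| < δ) → l2norm x < ε := by
  have hc : Continuous (l2norm : Data c d → ℝ) := by unfold l2norm; fun_prop
  obtain ⟨δ, hδ, h⟩ := Metric.continuous_iff.1 hc 0 ε hε
  refine ⟨δ, hδ, fun x hx => ?_⟩
  have := h x ((dist_pi_lt_iff hδ).2 fun i => (dist_pi_lt_iff hδ).2 fun p => by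
    simpa [Real.dist_eq] using hx i p)
  rw [Real.dist_eq] at this
  simpa [l2norm] using (le_abs_self _).trans_lt this

end CNN

/-- Deep narrow three-kernel zero padding CNNs, with channel sizes `c_x - W - ⋯ - W - c_y` where
`W = c_x + c_y + 2`, uniformly approximate continuous functions on compact sets. -/
theorem mainTheorem2 (σ : ℝ → ℝ) (hσ_cont : Continuous σ)
    (hσ_nonpoly : ¬ ∃ p : Polynomial ℝ, ∀ t : ℝ, σ t = p.eval t)
    (hσ_deriv : ∃ α : ℝ, ContDiffAt ℝ 1 σ α ∧ deriv σ α ≠ 0)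
    (cx cy d : ℕ) (K : Set (CNN.Data cx d)) (hK : IsCompact K)
    (f : CNN.Data cx d → CNN.Data cy d) (hf : ContinuousOn f K)
    (ε : ℝ) (hε : 0 < ε) :
    ∃ (n : ℕ) (g : CNN.Data cx d → CNN.Data cy d),
      CNN.IsCNN σ 1 d (cx :: (List.replicate n (cx + cy + 2) ++ [cy])) g ∧
        ∀ x ∈ K, CNN.l2norm (f x - g x) < ε := by
  obtain ⟨α, -, hα⟩ := hσ_deriv
  obtain ⟨δ, hδ, hl2⟩ := CNN.exists_l2norm_lt cy d hε
  obtain ⟨Φ, hΦ, hfΦ⟩ := CNN.exists_reach_dist_lt hα hσ_cont hσ_nonpoly hK hf (half_pos hδ)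
  obtain ⟨G, hG, hGd⟩ := hΦ.exists_dist_lt
    (hK.image (CNN.isPointwise_embed (cy := cy)).continuous) (half_pos hδ)
  obtain ⟨n, hn⟩ := hG.exists_isCNN
  refine ⟨n, _, hn, fun x hx => hl2 _ fun k q => ?_⟩
  have h₁ := hfΦ x hx k q
  have h₂ := (dist_pi_lt_iff (half_pos hδ)).1 ((dist_pi_lt_iff (half_pos hδ)).1
    (hGd _ ⟨x, hx, rfl⟩) (Fin.castAdd 2 (Fin.natAdd cx k))) q
  have h₃ : dist (Φ x k q) (CNN.outputs (G (CNN.pack x (0 : CNN.Data cy d) 0)) k q) < δ / 2 := by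
    rw [CNN.inputs_pack, CNN.outputs_pack, zero_add] at h₂
    simpa [CNN.pack, CNN.outputs] using h₂
  rw [Pi.sub_apply, Pi.sub_apply, ← Real.dist_eq]
  linarith [dist_triangle (f x k q) (Φ x k q)
    (CNN.outputs (G (CNN.pack x (0 : CNN.Data cy d) 0)) k q)]
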